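/- **Liveness of well-structured $\mathrm{PCMG}_\le$ with acyclic graph.** A (Petri) net $N=(P,T,W)$ consists of finite disjoint sets $P$ of places and $T$ of transitions and weights $W:(P\times T)\cup(T\times P)\to\mathbb N$; for a node $n$ write $n^\bullet=\{n' : W(n,n')>0\}$ and ${}^\bullet n=\{n' : W(n',n)>0\}$, and extend this to sets of places by unions. The net is an $\mathrm{MG}_\le$ if all weights are at most $1$ and $|{}^\bullet p|\le 1$, $|p^\bullet|\le 1$ for every place $p$; it is a marked graph (MG) if all weights are at most $1$ and $|{}^\bullet p|=|p^\bullet|=1$ for every place $p$. It is well-formed if it is structurally bounded (bounded from every marking) and structurally live (live from some marking). A siphon is a non-empty $D\subseteq P$ with ${}^\bullet D\subseteq D^\bullet$, a trap is a non-empty $Q\subseteq P$ with $Q^\bullet\subseteq{}^\bullet Q$; each is minimal if it contains no proper subset of the same type, and it is marked by $M_0$ if $M_0(p)>0$ for one of its places $p$. Let $G=(V,E)$ be a finite connected undirected graph whose edges join distinct vertices. A $\mathrm{PCMG}_\le$ $N$ is obtained from $G$ as follows. Take an $\mathrm{MG}_\le$ $N'$ whose maximal connected components each contain at least two places, a bijection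 $\beta$ from $E$ to the set of these components, and, for each edge $e=\{u,v\}$, two distinct places $p_{e,u}\neq p_{e,v}$ of the component $\beta(e)$. For each vertex $v$, merge all the places $p_{e,v}$ ($e\ni v$) into a single place, whose arc weights are the sums of those of the merged places; all other places, and all transitions, are kept. $N$ is well-structured if each component of $N'$ is a strongly connected and well-formed MG. **Theorem.** Let $S=(N,M_0)$ be a well-structured $\mathrm{PCMG}_\le$ system obtained from an acyclic undirected graph $G$ and having at least one transition. Then $S$ is live if and only if each minimal siphon of $N$ is marked by $M_0$; equivalently, $S$ is live if and only if each minimal trap of $N$ is marked by $M_0$. Moreover, the minimal siphons of $N$ are exactly its minimal traps. -/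

import Mathlib

/-- A weighted Petri net with places `P` and transitions `T` (which will be finite types);
`pre p t` is the weight `W(p,t)` and `post t p` is the weight `W(t,p)`. -/
structure PetriNet (P T : Type*) where
  pre : P → T → ℕ
  post : T → P → ℕ

namespace PetriNet

variable {P T : Type*}

/-! ### Structure: pre-sets, post-sets, arcs, connectedness -/

/-- The post-set `p•` of a place. -/
def placePost (N : PetriNet P T) (p : P) : Set T := {t | 0 < N.pre p t}

/-- The pre-set `•p` of a place. -/
def placePre (N : PetriNet P T) (p : P) : Set T := {t | 0 < N.post t p}

/-- The nodes of the net are the elements of `P ⊕ T`; there is an arc from `x` to `y` when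
`W(x,y) > 0`. -/
def Arc (N : PetriNet P T) : P ⊕ T → P ⊕ T → Prop
  | .inl p, .inr t => 0 < N.pre p t
  | .inr t, .inl p => 0 < N.post t p
  | _, _ => False

/-- The underlying undirected graph of the net. -/
def underlyingGraph (N : PetriNet P T) : SimpleGraph (P ⊕ T) := SimpleGraph.fromRel N.Arc

/-- Every node is reachable from every node by a directed path. -/
def StronglyConnected (N : PetriNet P T) : Prop :=
  ∀ x y : P ⊕ T, Relation.ReflTransGen N.Arc x y

/-- The maximal connected components of the net (as sets of nodes). -/
abbrev Component (N : PetriNet P T) : Type _ := N.underlyingGraph.ConnectedComponent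

/-- The component containing a place. -/
def placeComponent (N : PetriNet P T) (p : P) : N.Component :=
  N.underlyingGraph.connectedComponentMk (Sum.inl p)

/-- The component containing a transition. -/
def transComponent (N : PetriNet P T) (t : T) : N.Component :=
  N.underlyingGraph.connectedComponentMk (Sum.inr t)

/-- A maximal connected component, as a net: the restriction of `N` to its nodes. -/
def componentNet (N : PetriNet P T) (c : N.Component) :
    PetriNet {p : P // N.placeComponent p = c} {t : T // N.transComponent t = c} where
  pre p t := N.pre p.1 t.1
  post t p := N.post t.1 p.1

/-! ### Subclasses -/

/-- Ordinary (unit-weighted) nets: no arc weight exceeds `1`. -/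
def Ordinary (N : PetriNet P T) : Prop :=
  (∀ p t, N.pre p t ≤ 1) ∧ (∀ t p, N.post t p ≤ 1)

/-- `MG≤`: unit-weighted nets in which each place has at most one input and at most one output. -/
def IsMGLe (N : PetriNet P T) : Prop :=
  N.Ordinary ∧ ∀ p, (N.placePre p).encard ≤ 1 ∧ (N.placePost p).encard ≤ 1

/-- Marked graphs: unit-weighted nets in which each place has exactly one input and exactly one
output. -/
def IsMG (N : PetriNet P T) : Prop :=
  N.Ordinary ∧ ∀ p, (N.placePre p).encard = 1 ∧ (N.placePost p).encard = 1

/-! ### Behaviour -/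

/-- The incidence matrix. -/
def incidence (N : PetriNet P T) (p : P) (t : T) : ℤ := (N.post t p : ℤ) - (N.pre p t : ℤ)

/-- The transition `t` is enabled at the marking `M`. -/
def Enabled (N : PetriNet P T) (M : P → ℕ) (t : T) : Prop := ∀ p, N.pre p t ≤ M p

/-- `M [t⟩ M'`. -/
def Fires (N : PetriNet P T) (M : P → ℕ) (t : T) (M' : P → ℕ) : Prop :=
  N.Enabled M t ∧ ∀ p, (M' p : ℤ) = (M p : ℤ) + N.incidence p t

/-- `M'` is reachable from `M` by a finite (possibly empty) firing sequence. -/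
def Reachable (N : PetriNet P T) (M M' : P → ℕ) : Prop :=
  Relation.ReflTransGen (fun M₁ M₂ => ∃ t, N.Fires M₁ t M₂) M M'

/-- The system `(N, M₀)` is live: from every reachable marking, every transition can be enabled
again. -/
def Live (N : PetriNet P T) (M₀ : P → ℕ) : Prop :=
  ∀ t : T, ∀ M, N.Reachable M₀ M → ∃ M', N.Reachable M M' ∧ N.Enabled M' t

/-- The system `(N, M₀)` is bounded. -/
def Bounded (N : PetriNet P T) (M₀ : P → ℕ) : Prop :=
  ∃ k : ℕ, ∀ M, N.Reachable M₀ M → ∀ p, M p ≤ k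

def StructurallyLive (N : PetriNet P T) : Prop := ∃ M : P → ℕ, N.Live M

def StructurallyBounded (N : PetriNet P T) : Prop := ∀ M : P → ℕ, N.Bounded M

def WellFormed (N : PetriNet P T) : Prop := N.StructurallyBounded ∧ N.StructurallyLive

/-! ### Siphons and traps -/

/-- The post-set `D•` of a set of places. -/
def setPost (N : PetriNet P T) (D : Set P) : Set T := ⋃ p ∈ D, N.placePost p

/-- The pre-set `•D` of a set of places. -/
def setPre (N : PetriNet P T) (D : Set P) : Set T := ⋃ p ∈ D, N.placePre p

/-- (Non-empty) siphons: `•D ⊆ D•`. -/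
def IsSiphon (N : PetriNet P T) (D : Set P) : Prop := D.Nonempty ∧ N.setPre D ⊆ N.setPost D

/-- (Non-empty) traps: `Q• ⊆ •Q`. -/
def IsTrap (N : PetriNet P T) (Q : Set P) : Prop := Q.Nonempty ∧ N.setPost Q ⊆ N.setPre Q

/-- Siphons that contain no proper siphon. -/
def IsMinimalSiphon (N : PetriNet P T) (D : Set P) : Prop := Minimal N.IsSiphon D

/-- Traps that contain no proper trap. -/
def IsMinimalTrap (N : PetriNet P T) (Q : Set P) : Prop := Minimal N.IsTrap Q

/-- A set of places is marked by `M` when at least one of its places carries a token. -/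
def Marked (M : P → ℕ) (D : Set P) : Prop := ∃ p ∈ D, 0 < M p

/-! ### Place-merging -/

/-- The net obtained by place-merging a family `A` of sets of places (meant to be mutually
disjoint): every `A i` is replaced by one place whose arc weights are the sums of the weights over
the members of `A i`; the places that occur in no `A i` are kept. -/
def placeMerge (N : PetriNet P T) {ι : Type*} (A : ι → Finset P) :
    PetriNet (ι ⊕ {p : P // ∀ i, p ∉ A i}) T where
  pre x t := Sum.elim (fun i => ∑ p ∈ A i, N.pre p t) (fun p => N.pre p.1 t) x
  post t x := Sum.elim (fun i => ∑ p ∈ A i, N.post t p) (fun p => N.post t p.1) x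

end PetriNet

/-- A refinement of the connected undirected graph `G` into a place-composed marked graph with
relaxed place constraints (`PCMG≤`). -/
structure PCMGRefinement {V : Type*} (G : SimpleGraph V) (P T : Type*) where
  /-- the graph is connected -/
  connected : G.Connected
  /-- the net `N'` whose places are to be merged -/
  base : PetriNet P T
  base_isMGLe : base.IsMGLe
  /-- each maximal connected component contains at least two places -/
  two_places : ∀ c : base.Component, 2 ≤ {p : P | base.placeComponent p = c}.encard
  /-- the bijection from edges to components -/
  β : G.edgeSet ≃ base.Component
  /-- the places attached to the two ends of each edge -/
  γ : (e : G.edgeSet) → {v : V // v ∈ (e : Sym2 V)} → P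
  γ_injective : ∀ e, Function.Injective (γ e)
  γ_mem : ∀ e v, base.placeComponent (γ e v) = β e

namespace PCMGRefinement

variable {V P T : Type*} [Fintype P] {G : SimpleGraph V}

open Classical in
/-- The set of all places attached to the vertex `v`. -/
noncomputable def mergeSet (R : PCMGRefinement G P T) (v : V) : Finset P :=
  {p : P | ∃ (e : G.edgeSet) (h : v ∈ (e : Sym2 V)), R.γ e ⟨v, h⟩ = p}

/-- The sets of places attached to distinct vertices are disjoint, so that merging them is
meaningful. -/
theorem mergeSet_disjoint (R : PCMGRefinement G P T) {u v : V} (huv : u ≠ v) :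
    Disjoint (R.mergeSet u) (R.mergeSet v) := by
  classical
  rw [Finset.disjoint_left]
  intro p hu hv
  simp only [mergeSet, Finset.mem_filter, Finset.mem_univ, true_and] at hu hv
  obtain ⟨e, he, rfl⟩ := hu
  obtain ⟨f, hf, hfe⟩ := hv
  have hef : f = e := R.β.injective (by rw [← R.γ_mem e ⟨u, he⟩, ← R.γ_mem f ⟨v, hf⟩, hfe])
  subst hef
  exact huv (congrArg Subtype.val (R.γ_injective f hfe)).symm

/-- The places of the `PCMG≤`: one for each vertex, and the places of `N'` attached to no vertex. -/
abbrev Place (R : PCMGRefinement G P T) : Type _ := V ⊕ {p : P // ∀ v, p ∉ R.mergeSet v}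

/-- The `PCMG≤` obtained from `G`. -/
noncomputable def net (R : PCMGRefinement G P T) : PetriNet R.Place T :=
  R.base.placeMerge R.mergeSet

/-- Each component is a strongly connected and well-formed marked graph. -/
def WellStructured (R : PCMGRefinement G P T) : Prop :=
  ∀ c : R.base.Component, (R.base.componentNet c).StronglyConnected ∧
    (R.base.componentNet c).WellFormed ∧ (R.base.componentNet c).IsMG

end PCMGRefinement

/-! Label each transition by its component of `R.base`. The edges of an acyclic graph are bridges,
so at a place `x` next to a component the net is cut: a set `K` of places contains `x`, meets that
component only in `x`, and is not left by any transition of another component. `LocallyCut` records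
this, with the fact that `x` has one input and one output in each adjacent component.

Minimal siphons are traps because a siphon containing `p` but no output place of some `t` in `p•`
stays a siphon when the side `K` of `p` is removed (`LocallyCut.isTrap_of_isMinimalSiphon`).
Reversing the arcs gives the converse.

If the net is not live, run it until its set of dead transitions is stable and non-empty. A semiflow
truncated to `K` shows that deadness spreads from the input to the output of a place within one
component (`LocallyCut.dead_of_input_dead`), so by strong connectedness each component is wholly
dead or has no dead transition. Runs on different sides of a dead component are independent, so its
transitions can only be blocked by unmarked places all of whose neighbours are dead. These places
form an unmarked siphon (`LocallyCut.exists_unmarked_isSiphon`). A minimal siphon inside it is a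
trap, marked initially and hence forever: a contradiction. -/

namespace PetriNet

/-! ### Siphons, traps, dead transitions and runs in general nets. -/

section Behaviour

variable {P T : Type*} {N : PetriNet P T}

/-- A place and a transition joined by an arc in either direction. -/
def Adj (N : PetriNet P T) (p : P) (t : T) : Prop := 0 < N.pre p t ∨ 0 < N.post t p

/-- The net with all arcs reversed. -/
def reverse (N : PetriNet P T) : PetriNet P T where
  pre p t := N.post t p
  post t p := N.pre p t

/-- No marking reachable from `M` enables `t`. -/
def Dead (N : PetriNet P T) (M : P → ℕ) (t : T) : Prop :=
  ∀ M', N.Reachable M M' → ¬ N.Enabled M' t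

theorem adj_reverse {p : P} {t : T} : N.reverse.Adj p t ↔ N.Adj p t := or_comm

theorem isSiphon_iff {D : Set P} : N.IsSiphon D ↔
    D.Nonempty ∧ ∀ t, ∀ p ∈ D, 0 < N.post t p → ∃ q ∈ D, 0 < N.pre q t := by
  simp only [IsSiphon, setPre, setPost, placePre, placePost, Set.subset_def, Set.mem_iUnion,
    Set.mem_ofPred_eq, exists_prop, forall_exists_index, and_imp]

theorem isTrap_iff {D : Set P} : N.IsTrap D ↔
    D.Nonempty ∧ ∀ t, ∀ p ∈ D, 0 < N.pre p t → ∃ q ∈ D, 0 < N.post t q := by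
  simp only [IsTrap, setPre, setPost, placePre, placePost, Set.subset_def, Set.mem_iUnion,
    Set.mem_ofPred_eq, exists_prop, forall_exists_index, and_imp]

theorem exists_isMinimalSiphon_subset [Finite P] {D : Set P} (hD : N.IsSiphon D) :
    ∃ X ⊆ D, N.IsMinimalSiphon X :=
  exists_minimal_le_of_wellFoundedLT N.IsSiphon D hD

theorem exists_isMinimalTrap_subset [Finite P] {D : Set P} (hD : N.IsTrap D) :
    ∃ X ⊆ D, N.IsMinimalTrap X :=
  exists_minimal_le_of_wellFoundedLT N.IsTrap D hD

theorem Fires.exists_of_enabled {M : P → ℕ} {t : T} (h : N.Enabled M t) :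
    ∃ M', N.Fires M t M' := by
  refine ⟨fun p => M p + N.post t p - N.pre p t, h, fun p => ?_⟩
  have := h p
  simp only [incidence]
  omega

theorem IsTrap.marked_of_reachable {Q : Set P} (hQ : N.IsTrap Q) {M M' : P → ℕ}
    (hM : Marked M Q) (h : N.Reachable M M') : Marked M' Q := by
  induction h with
  | refl => exact hM
  | @tail A B _ hAB ih =>
    obtain ⟨t, hE, hf⟩ := hAB
    obtain ⟨p, hp, hpA⟩ := ih
    by_cases hpt : 0 < N.pre p t
    · obtain ⟨q, hq, hqt⟩ := (isTrap_iff.1 hQ).2 t p hp hpt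
      by_cases hqt' : 0 < N.pre q t
      · have h1 := hf q
        have h2 := hE q
        refine ⟨q, hq, ?_⟩
        simp only [incidence] at h1
        omega
      · have h1 := hf q
        refine ⟨q, hq, ?_⟩
        simp only [incidence] at h1
        omega
    · have h1 := hf p
      refine ⟨p, hp, ?_⟩
      simp only [incidence] at h1
      omega

theorem IsSiphon.not_marked_of_reachable {D : Set P} (hD : N.IsSiphon D) {M M' : P → ℕ}
    (hM : ¬ Marked M D) (h : N.Reachable M M') : ¬ Marked M' D := by
  induction h with
  | refl => exact hM
  | @tail A B _ hAB ih =>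
    obtain ⟨t, hE, hf⟩ := hAB
    rintro ⟨p, hp, hpB⟩
    have hpA : A p = 0 := by
      by_contra h0
      exact ih ⟨p, hp, Nat.pos_of_ne_zero h0⟩
    have h1 := hf p
    simp only [incidence] at h1
    obtain ⟨q, hq, hqt⟩ := (isSiphon_iff.1 hD).2 t p hp (by omega)
    exact ih ⟨q, hq, hqt.trans_le (hE q)⟩

theorem Live.marked_of_isSiphon {M : P → ℕ} (hM : N.Live M) {D : Set P} (hD : N.IsSiphon D)
    (hout : ∀ p, ∃ t, 0 < N.pre p t) : Marked M D := by
  by_contra hu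
  obtain ⟨p, hp⟩ := hD.1
  obtain ⟨t, ht⟩ := hout p
  obtain ⟨M', hM', hE⟩ := hM t M .refl
  exact hD.not_marked_of_reachable hu hM' ⟨p, hp, ht.trans_le (hE p)⟩

theorem Dead.of_reachable {M M' : P → ℕ} {t : T} (h : N.Dead M t) (hM : N.Reachable M M') :
    N.Dead M' t := fun _ hA => h _ (hM.trans hA)

/-- Dead transitions stay dead, so a reachable marking with a maximal set of them has a stable set.
-/
theorem exists_reachable_dead_iff [Finite T] (M : P → ℕ) :
    ∃ M₁, N.Reachable M M₁ ∧ ∀ M₂, N.Reachable M₁ M₂ → ∀ t, N.Dead M₂ t ↔ N.Dead M₁ t := by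
  obtain ⟨S, hS⟩ := exists_maximal_ge_of_wellFoundedGT
    (fun S : Set T => ∃ M₁, N.Reachable M M₁ ∧ S = {t | N.Dead M₁ t}) _ ⟨M, .refl, rfl⟩
  obtain ⟨M₁, hM₁, rfl⟩ := hS.2.prop
  refine ⟨M₁, hM₁, fun M₂ h t => ⟨fun ht => ?_, fun ht => ht.of_reachable h⟩⟩
  exact hS.2.le_of_ge ⟨M₂, hM₁.trans h, rfl⟩ (fun s hs => Dead.of_reachable hs h) ht

/-- If no live transition increases a weighted token count, then those that decrease it are dead. -/
theorem dead_of_potential [Fintype P] {M : P → ℕ}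
    (hM : ∀ M', N.Reachable M M' → ∀ t, N.Dead M' t ↔ N.Dead M t)
    (y : P → ℕ) (hy : ∀ t, ¬ N.Dead M t → ∑ x, (y x : ℤ) * N.incidence x t ≤ 0)
    {t : T} (ht : ∑ x, (y x : ℤ) * N.incidence x t < 0) : N.Dead M t := by
  by_contra htd
  have step : ∀ A B s, N.Fires A s B →
      ∑ x, (y x : ℤ) * B x = ∑ x, (y x : ℤ) * A x + ∑ x, (y x : ℤ) * N.incidence x s := by
    intro A B s h
    rw [← Finset.sum_add_distrib]
    exact Finset.sum_congr rfl fun x _ => by rw [h.2 x]; ring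
  have mono : ∀ A B, N.Reachable M A → N.Reachable A B →
      ∑ x, (y x : ℤ) * B x ≤ ∑ x, (y x : ℤ) * A x := by
    intro A B hA hB
    induction hB with
    | refl => exact le_rfl
    | @tail B C hB hC ih =>
      obtain ⟨s, hs⟩ := hC
      have hsd : ¬ N.Dead M s := fun hd => hd B (Relation.ReflTransGen.trans hA hB) hs.1
      have := step B C s hs
      have := hy s hsd
      omega
  -- A live `t` can always be fired again, each time lowering by at least one a count that never
  -- rises; but the count is nonnegative.
  have key : ∀ n : ℕ, ∀ A, N.Reachable M A → ∑ x, (y x : ℤ) * A x < n → False := by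
    intro n
    induction n with
    | zero =>
      intro A _ h
      have : 0 ≤ ∑ x, (y x : ℤ) * A x := Finset.sum_nonneg fun x _ => by positivity
      simp only [Nat.cast_zero] at h
      omega
    | succ n ih =>
      intro A hA h
      have hAd : ¬ N.Dead A t := by rwa [hM A hA t]
      simp only [Dead, not_forall, not_not] at hAd
      obtain ⟨B, hB, hE⟩ := hAd
      obtain ⟨C, hC⟩ := Fires.exists_of_enabled hE
      have h1 := mono A B hA hB
      have h2 := step B C t hC
      refine ih C ((Relation.ReflTransGen.trans hA hB).tail ⟨t, hC⟩) ?_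
      push_cast at h
      omega
  have h0 : 0 ≤ ∑ x, (y x : ℤ) * M x := Finset.sum_nonneg fun x _ => by positivity
  refine key ((∑ x, (y x : ℤ) * M x).toNat + 1) M .refl ?_
  push_cast
  omega

open Classical in
/-- If no live transition joins `K` to its complement, then a run can be restricted to `K`. -/
theorem reachable_piecewise {M M' : P → ℕ} {K : Set P}
    (hK : ∀ t, ¬ N.Dead M t → ∀ x y, N.Adj x t → N.Adj y t → x ∈ K → y ∈ K)
    (h : N.Reachable M M') : N.Reachable M (K.piecewise M' M) := by
  induction h with
  | refl => rw [Set.piecewise_same]; exact .refl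
  | @tail A B hA hB ih =>
    obtain ⟨t, hE, hf⟩ := hB
    have htd : ¬ N.Dead M t := fun hd => hd A hA hE
    by_cases hx : ∃ x ∈ K, N.Adj x t
    -- A transition touching `K` has all its places in `K` and is replayed; any other one is
    -- dropped.
    · obtain ⟨x, hxK, hxt⟩ := hx
      refine ih.tail ⟨t, fun p => ?_, fun p => ?_⟩
      · by_cases hp : p ∈ K
        · simpa [hp] using hE p
        · have : N.pre p t = 0 := by
            by_contra h0
            exact hp (hK t htd x p hxt (.inl (Nat.pos_of_ne_zero h0)) hxK)
          omega
      · by_cases hp : p ∈ K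
        · simpa [hp] using hf p
        · have h1 : N.pre p t = 0 := by
            by_contra h0
            exact hp (hK t htd x p hxt (.inl (Nat.pos_of_ne_zero h0)) hxK)
          have h2 : N.post t p = 0 := by
            by_contra h0
            exact hp (hK t htd x p hxt (.inr (Nat.pos_of_ne_zero h0)) hxK)
          simp [hp, incidence, h1, h2]
    · convert ih using 1
      funext p
      by_cases hp : p ∈ K
      · have hn : ¬ N.Adj p t := fun h => hx ⟨p, hp, h⟩
        simp only [Adj, not_or, not_lt, nonpos_iff_eq_zero] at hn
        have := hf p
        simp only [incidence, hn] at this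
        simp only [hp, Set.piecewise_eq_of_mem]
        omega
      · simp [hp]

end Behaviour

/-! ### Locally cut nets: minimal siphons and minimal traps coincide. -/

/-- Nets whose transitions are labelled in such a way that every place has, for each label among
its neighbours, exactly one input and one output with that label, and can be separated by a cut from
the remainder of that label. -/
structure LocallyCut {P T E : Type*} (N : PetriNet P T) (τ : T → E) : Prop where
  input_unique : ∀ {p s t}, 0 < N.post s p → 0 < N.post t p → τ s = τ t → s = t
  output_unique : ∀ {p s t}, 0 < N.pre p s → 0 < N.pre p t → τ s = τ t → s = t
  exists_input : ∀ {p t}, N.Adj p t → ∃ s, τ s = τ t ∧ 0 < N.post s p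
  exists_output : ∀ {p t}, N.Adj p t → ∃ s, τ s = τ t ∧ 0 < N.pre p s
  cut : ∀ {p t}, N.Adj p t → ∃ K : Set P, p ∈ K ∧
    (∀ s, τ s ≠ τ t → ∀ x y, N.Adj x s → N.Adj y s → x ∈ K → y ∈ K) ∧
    (∀ s, τ s = τ t → ∀ x, N.Adj x s → x ∈ K → x = p)

namespace LocallyCut

variable {P T E : Type*} {N : PetriNet P T} {τ : T → E}

theorem reverse (h : N.LocallyCut τ) : N.reverse.LocallyCut τ where
  input_unique := h.output_unique
  output_unique := h.input_unique
  exists_input h' := h.exists_output (adj_reverse.1 h')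
  exists_output h' := h.exists_input (adj_reverse.1 h')
  cut h' := by simpa only [adj_reverse] using h.cut (adj_reverse.1 h')

/-- If `t` takes from `p ∈ D` and feeds no place of `D`, then `D \ K` is a smaller siphon. Among
transitions with the label of `t`, only `t` takes from `D ∩ K ⊆ {p}`, and it needs no input since it
feeds nothing in `D`. It is non-empty because the input of `p` with that label has an input place in
it. -/
theorem isTrap_of_isMinimalSiphon (h : N.LocallyCut τ) {D : Set P} (hD : N.IsMinimalSiphon D) :
    N.IsTrap D := by
  have hS := isSiphon_iff.1 hD.prop
  refine isTrap_iff.2 ⟨hS.1, fun t p hp hpt => ?_⟩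
  by_contra! hno
  obtain ⟨K, hpK, hout, hin⟩ := h.cut (Or.inl hpt : N.Adj p t)
  have key : ∀ s, τ s = τ t → (∃ x ∈ D, 0 < N.post s x) → ∃ q ∈ D \ K, 0 < N.pre q s := by
    rintro s hs ⟨x, hx, hsx⟩
    obtain ⟨q, hq, hqs⟩ := hS.2 s x hx hsx
    refine ⟨q, ⟨hq, fun hqK => ?_⟩, hqs⟩
    obtain rfl := hin s hs q (.inl hqs) hqK
    obtain rfl := h.output_unique hqs hpt hs
    exact absurd hsx (not_lt.2 (hno x hx))
  have hD' : N.IsSiphon (D \ K) := by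
    refine isSiphon_iff.2 ⟨?_, fun s x hx hsx => ?_⟩
    · obtain ⟨s, hs, hsp⟩ := h.exists_input (Or.inl hpt : N.Adj p t)
      obtain ⟨q, hq, -⟩ := key s hs ⟨p, hp, hsp⟩
      exact ⟨q, hq⟩
    · by_cases hs : τ s = τ t
      · exact key s hs ⟨x, hx.1, hsx⟩
      · obtain ⟨q, hq, hqs⟩ := hS.2 s x hx.1 hsx
        exact ⟨q, ⟨hq, fun hqK => hx.2 (hout s hs q x (.inl hqs) (.inr hsx) hqK)⟩, hqs⟩
  exact (hD.le_of_le hD' Set.sdiff_subset hp).2 hpK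

theorem isSiphon_of_isMinimalTrap (h : N.LocallyCut τ) {D : Set P} (hD : N.IsMinimalTrap D) :
    N.IsSiphon D :=
  h.reverse.isTrap_of_isMinimalSiphon (D := D) hD

/-- A minimal siphon is a trap, so it contains a minimal trap; this is again a siphon, and
minimality makes the two equal. The other direction is symmetric. -/
theorem isMinimalSiphon_iff_isMinimalTrap [Finite P] (h : N.LocallyCut τ) (D : Set P) :
    N.IsMinimalSiphon D ↔ N.IsMinimalTrap D := by
  constructor
  · intro hD
    obtain ⟨X, hXD, hX⟩ := exists_isMinimalTrap_subset (h.isTrap_of_isMinimalSiphon hD)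
    rwa [← hXD.antisymm (hD.le_of_le (h.isSiphon_of_isMinimalTrap hX) hXD)]
  · intro hD
    obtain ⟨X, hXD, hX⟩ := exists_isMinimalSiphon_subset (h.isSiphon_of_isMinimalTrap hD)
    rwa [← hXD.antisymm (hD.le_of_le (h.isTrap_of_isMinimalSiphon hX) hXD)]

/-! ### Locally cut nets: liveness from marked minimal siphons. -/

section Live

variable {M : P → ℕ}

/-- If all transitions with the label of `t` are dead, and each input place of `t` is marked or has
a live output, then `t` can be enabled. -/
theorem exists_reachable_marked (h : N.LocallyCut τ)
    (hM : ∀ M', N.Reachable M M' → ∀ t, N.Dead M' t ↔ N.Dead M t)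
    {t : T} (ht : ∀ s, τ s = τ t → N.Dead M s)
    (hin : ∀ p, 0 < N.pre p t → 0 < M p ∨ ∃ s, 0 < N.pre p s ∧ ¬ N.Dead M s)
    (F : Finset P) (hF : ∀ p ∈ F, 0 < N.pre p t) :
    ∃ M', N.Reachable M M' ∧ (∀ p ∈ F, 0 < M' p) ∧
      ∀ p, 0 < N.pre p t → p ∉ F → M' p = M p := by
  classical
  induction F using Finset.induction_on with
  | empty => exact ⟨M, .refl, by simp, by simp⟩
  | insert p F hpF ih =>
    obtain ⟨A, hA, hAF, hAeq⟩ := ih fun q hq => hF q (Finset.mem_insert_of_mem hq)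
    have hpt := hF p (Finset.mem_insert_self p F)
    rcases hin p hpt with hp | ⟨s, hps, hsd⟩
    · refine ⟨A, hA, fun q hq => ?_, fun q hq hqF => hAeq q hq fun h' => hqF (by simp [h'])⟩
      rcases Finset.mem_insert.1 hq with rfl | hq
      · rwa [hAeq q hpt hpF]
      · exact hAF q hq
    · have hsA : ¬ N.Dead A s := by rwa [hM A hA s]
      simp only [Dead, not_forall, not_not] at hsA
      obtain ⟨B, hB, hBs⟩ := hsA
      -- The run to `B`, where `s` is enabled and so `p` is marked, is replayed only inside `K`. The
      -- other input places of `t` lie outside `K` and keep their tokens.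
      obtain ⟨K, hpK, hout, hK⟩ := h.cut (Or.inl hpt : N.Adj p t)
      have hpw := reachable_piecewise (K := K) (fun r hr =>
        hout r fun hrt => hr ((hM A hA r).2 (ht r hrt))) hB
      have hne : ∀ q, 0 < N.pre q t → q ≠ p → q ∉ K := fun q hq hqp hqK =>
        hqp (hK t rfl q (.inl hq) hqK)
      refine ⟨_, hA.trans hpw, fun q hq => ?_, fun q hq hqF => ?_⟩
      · by_cases hqp : q = p
        · subst hqp
          simpa [hpK] using hps.trans_le (hBs q)
        · have hqF := (Finset.mem_insert.1 hq).resolve_left hqp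
          simpa [hne q (hF q hq) hqp] using hAF q hqF
      · simp only [Finset.mem_insert, not_or] at hqF
        simpa [hne q hq hqF.1] using hAeq q hq hqF.2

/-- The siphon consists of the unmarked places all of whose neighbours are dead. Each dead
transition has such an input place: otherwise all its inputs could be marked together, which enables
it as the weights are at most one. -/
theorem exists_unmarked_isSiphon [Finite P] (h : N.LocallyCut τ) (hN : ∀ p t, N.pre p t ≤ 1)
    (hM : ∀ M', N.Reachable M M' → ∀ t, N.Dead M' t ↔ N.Dead M t)
    (hτ : ∀ s t, τ s = τ t → N.Dead M s → N.Dead M t) {t : T} (ht : N.Dead M t) :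
    ∃ D, N.IsSiphon D ∧ ¬ Marked M D := by
  cases nonempty_fintype P
  classical
  have key : ∀ t, N.Dead M t → ∃ p, (M p = 0 ∧ ∀ s, N.Adj p s → N.Dead M s) ∧ 0 < N.pre p t := by
    intro t ht
    by_contra! hno
    have hin : ∀ p, 0 < N.pre p t → 0 < M p ∨ ∃ s, 0 < N.pre p s ∧ ¬ N.Dead M s := by
      intro p hp
      by_contra! hc
      refine absurd hp (not_lt.2 (hno p ⟨by omega, fun s hs => ?_⟩))
      obtain ⟨r, hr, hpr⟩ := h.exists_output hs
      exact hτ r s hr (hc.2 r hpr)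
    obtain ⟨A, hA, hAF, -⟩ := h.exists_reachable_marked hM (fun s hs => hτ t s hs.symm ht) hin
      (Finset.univ.filter fun p => 0 < N.pre p t) (by simp)
    refine ht A hA fun p => ?_
    rcases Nat.eq_zero_or_pos (N.pre p t) with h0 | h0
    · omega
    · have := hAF p (by simpa using h0)
      have := hN p t
      omega
  refine ⟨{p | M p = 0 ∧ ∀ s, N.Adj p s → N.Dead M s}, isSiphon_iff.2 ⟨?_, ?_⟩, ?_⟩
  · obtain ⟨p, hp, -⟩ := key t ht
    exact ⟨p, hp⟩
  · intro s p hp hsp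
    exact key s (hp.2 s (.inr hsp))
  · rintro ⟨p, hp, hp'⟩
    have := hp.1
    omega

/-- The potential `y` changes under transitions of this label only through `p`. Only `s` could
refill `p` from this component, so with `s` dead no live transition raises the potential, while `t`
lowers it. -/
theorem dead_of_input_dead [Fintype P] (h : N.LocallyCut τ)
    (hpot : ∀ p t, N.Adj p t → ∃ y : P → ℕ, 0 < y p ∧
      (∀ s, τ s ≠ τ t → ∑ x, (y x : ℤ) * N.incidence x s = 0) ∧
      (∀ s, τ s = τ t → ∀ x, N.Adj x s → y x ≠ 0 → x = p))
    (hM : ∀ M', N.Reachable M M' → ∀ t, N.Dead M' t ↔ N.Dead M t)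
    {p : P} {s t : T} (hst : τ s = τ t) (hsp : 0 < N.post s p) (hpt : 0 < N.pre p t)
    (hs : N.Dead M s) : N.Dead M t := by
  by_contra htd
  obtain ⟨y, hyp, hy0, hy1⟩ := hpot p t (.inl hpt)
  have hsum : ∀ r, τ r = τ t →
      ∑ x, (y x : ℤ) * N.incidence x r = (y p : ℤ) * N.incidence p r := by
    intro r hr
    refine Finset.sum_eq_single p (fun x _ hx => ?_) (by simp)
    by_cases hadj : N.Adj x r
    · by_cases hyx : y x = 0
      · simp [hyx]
      · exact absurd (hy1 r hr x hadj hyx) hx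
    · simp only [Adj, not_or, not_lt, nonpos_iff_eq_zero] at hadj
      simp [incidence, hadj]
  have hpost : ∀ r, τ r = τ t → ¬ N.Dead M r → N.post r p = 0 := by
    intro r hr hrd
    by_contra h0
    obtain rfl := h.input_unique (Nat.pos_of_ne_zero h0) hsp (hr.trans hst.symm)
    exact hrd hs
  refine htd (dead_of_potential hM y (fun r hr => ?_) (t := t) ?_)
  · by_cases hrt : τ r = τ t
    · rw [hsum r hrt, incidence, hpost r hrt hr]
      exact mul_nonpos_of_nonneg_of_nonpos (by positivity) (by simp)
    · exact (hy0 r hrt).le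
  · rw [hsum t rfl, incidence, hpost t rfl htd]
    exact mul_neg_of_pos_of_neg (by exact_mod_cast hyp) (by simpa using hpt)

theorem live_of_marked [Fintype P] [Finite T] (h : N.LocallyCut τ) (hN : ∀ p t, N.pre p t ≤ 1)
    (hpot : ∀ p t, N.Adj p t → ∃ y : P → ℕ, 0 < y p ∧
      (∀ s, τ s ≠ τ t → ∑ x, (y x : ℤ) * N.incidence x s = 0) ∧
      (∀ s, τ s = τ t → ∀ x, N.Adj x s → y x ≠ 0 → x = p))
    (hconn : ∀ s t, τ s = τ t → Relation.ReflTransGen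
      (fun a b => τ a = τ b ∧ ∃ p, 0 < N.post a p ∧ 0 < N.pre p b) s t)
    {M₀ : P → ℕ} (hM₀ : ∀ D, N.IsMinimalSiphon D → Marked M₀ D) : N.Live M₀ := by
  intro t A hA
  by_contra! hno
  obtain ⟨M, hAM, hM⟩ := N.exists_reachable_dead_iff A
  have htd : N.Dead M t := Dead.of_reachable hno hAM
  have hτ : ∀ s t, τ s = τ t → N.Dead M s → N.Dead M t := by
    intro s t hst hs
    have hr := hconn s t hst
    clear hst
    induction hr with
    | refl => exact hs
    | tail _ hab ih =>
      obtain ⟨hab, p, hap, hpb⟩ := hab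
      exact h.dead_of_input_dead hpot hM hab hap hpb ih
  obtain ⟨D, hD, hDM⟩ := h.exists_unmarked_isSiphon hN hM hτ htd
  obtain ⟨X, hXD, hX⟩ := exists_isMinimalSiphon_subset hD
  -- As a trap, `X` keeps its initial marking, although it lies in the unmarked `D`.
  obtain ⟨p, hp, hpM⟩ := (h.isTrap_of_isMinimalSiphon hX).marked_of_reachable (hM₀ X hX)
    (hA.trans hAM)
  exact hDM ⟨p, hXD hp, hpM⟩

end Live

end LocallyCut

end PetriNet

/-! ### Semiflows of strongly connected marked graphs. -/

namespace PetriNet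

section MarkedGraph

variable {P T : Type*} {N : PetriNet P T}

theorem placeComponent_eq_of_pre {p : P} {t : T} (h : 0 < N.pre p t) :
    N.placeComponent p = N.transComponent t :=
  SimpleGraph.ConnectedComponent.sound
    (SimpleGraph.Adj.reachable ((SimpleGraph.fromRel_adj _ _ _).2 ⟨by simp, .inl h⟩))

theorem placeComponent_eq_of_post {p : P} {t : T} (h : 0 < N.post t p) :
    N.placeComponent p = N.transComponent t :=
  SimpleGraph.ConnectedComponent.sound
    (SimpleGraph.Adj.reachable ((SimpleGraph.fromRel_adj _ _ _).2 ⟨by simp, .inr h⟩))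

theorem placeComponent_eq_of_adj {p : P} {t : T} (h : N.Adj p t) :
    N.placeComponent p = N.transComponent t :=
  h.elim placeComponent_eq_of_pre placeComponent_eq_of_post

theorem exists_trans_of_stronglyConnected {c : N.Component}
    (hc : (N.componentNet c).StronglyConnected) {s t : T} (hs : N.transComponent s = c)
    (ht : N.transComponent t = c) :
    Relation.ReflTransGen (fun a b => ∃ p, 0 < N.post a p ∧ 0 < N.pre p b) s t := by
  suffices key : ∀ y : {p : P // N.placeComponent p = c} ⊕ {t : T // N.transComponent t = c},
      Relation.ReflTransGen (N.componentNet c).Arc (.inr ⟨s, hs⟩) y →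
      Sum.elim (fun p => ∃ a, Relation.ReflTransGen
          (fun a b => ∃ p, 0 < N.post a p ∧ 0 < N.pre p b) s a ∧ 0 < N.post a p.1)
        (fun t => Relation.ReflTransGen
          (fun a b => ∃ p, 0 < N.post a p ∧ 0 < N.pre p b) s t.1) y from
    key (.inr ⟨t, ht⟩) (hc _ _)
  intro y hy
  induction hy with
  | refl => exact .refl
  | @tail y z _ hyz ih =>
    rcases y with p | a <;> rcases z with q | b
    · exact hyz.elim
    · obtain ⟨a, ha, hap⟩ := ih
      exact ha.tail ⟨p.1, hap, hyz⟩
    · exact ⟨a.1, ih, hyz⟩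
    · exact hyz.elim

open Classical in
theorem IsMG.exists_input_output (hN : N.IsMG) (p : P) : ∃ a b : T,
    (∀ t, N.post t p = if t = a then 1 else 0) ∧ ∀ t, N.pre p t = if t = b then 1 else 0 := by
  obtain ⟨a, ha⟩ := Set.encard_eq_one.1 (hN.2 p).1
  obtain ⟨b, hb⟩ := Set.encard_eq_one.1 (hN.2 p).2
  refine ⟨a, b, fun t => ?_, fun t => ?_⟩
  · have h1 : 0 < N.post t p ↔ t = a := by simpa [placePre] using Set.ext_iff.1 ha t
    have h2 := hN.1.2 t p
    split_ifs with h
    · have := h1.2 h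
      omega
    · have := mt h1.1 h
      omega
  · have h1 : 0 < N.pre p t ↔ t = b := by simpa [placePost] using Set.ext_iff.1 hb t
    have h2 := hN.1.1 p t
    split_ifs with h
    · have := h1.2 h
      omega
    · have := mt h1.1 h
      omega

theorem IsMGLe.input_unique (hN : N.IsMGLe) {p : P} {s t : T} (hs : 0 < N.post s p)
    (ht : 0 < N.post t p) : s = t :=
  Set.encard_le_one_iff.1 (hN.2 p).1 s t hs ht

theorem IsMGLe.output_unique (hN : N.IsMGLe) {p : P} {s t : T} (hs : 0 < N.pre p s)
    (ht : 0 < N.pre p t) : s = t :=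
  Set.encard_le_one_iff.1 (hN.2 p).2 s t hs ht

theorem IsMG.isMGLe (hN : N.IsMG) : N.IsMGLe :=
  ⟨hN.1, fun p => ⟨(hN.2 p).1.le, (hN.2 p).2.le⟩⟩

open Classical in
/-- The occurrence count of the places of a path, which avoids the places of `B`. -/
theorem exists_path_count [Fintype P] (hN : N.IsMG) {B : Set P} {a b : T}
    (h : Relation.ReflTransGen (fun a b => ∃ p, p ∉ B ∧ 0 < N.post a p ∧ 0 < N.pre p b) a b) :
    ∃ c : P → ℕ, (∀ p ∈ B, c p = 0) ∧ ∀ t, ∑ p, (c p : ℤ) * N.incidence p t =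
      (if t = a then 1 else 0) - (if t = b then 1 else 0) := by
  induction h with
  | refl => exact ⟨0, by simp, by simp⟩
  | @tail b d _ hbd ih =>
    obtain ⟨c, hcB, hc⟩ := ih
    obtain ⟨p, hpB, hbp, hpd⟩ := hbd
    obtain ⟨x, y, hx, hy⟩ := hN.exists_input_output p
    obtain rfl : b = x := by
      by_contra h0
      simp [hx, h0] at hbp
    obtain rfl : d = y := by
      by_contra h0
      simp [hy, h0] at hpd
    -- The row of `p` is `+1` at `b` and `-1` at `d`, so the sum telescopes.
    refine ⟨c + Pi.single p 1, fun q hq => ?_, fun t => ?_⟩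
    · have : q ≠ p := fun h => hpB (h ▸ hq)
      simp [hcB q hq, this]
    · have : ∑ q, ((Pi.single p 1 : P → ℕ) q : ℤ) * N.incidence q t = N.incidence p t := by
        rw [Finset.sum_eq_single p] <;> simp +contextual
      simp only [Pi.add_apply, Nat.cast_add, add_mul, Finset.sum_add_distrib, this, hc]
      simp only [incidence, hx, hy]
      push_cast
      ring

/-- A step through `p` arrives at `a`, where the path may restart; a step through `q` leaves from
`b`, where it may already stop. -/
theorem exists_path_avoiding (hN : N.IsMG) {p q : P} {a b : T} (ha : 0 < N.pre p a)
    (hb : 0 < N.post b q)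
    (h : Relation.ReflTransGen (fun a b => ∃ p, 0 < N.post a p ∧ 0 < N.pre p b) a b) :
    Relation.ReflTransGen
      (fun a b => ∃ r, r ∉ ({p, q} : Set P) ∧ 0 < N.post a r ∧ 0 < N.pre r b) a b := by
  by_contra hno
  suffices key : ∀ d, Relation.ReflTransGen
      (fun a b => ∃ p, 0 < N.post a p ∧ 0 < N.pre p b) a d → Relation.ReflTransGen
      (fun a b => ∃ r, r ∉ ({p, q} : Set P) ∧ 0 < N.post a r ∧ 0 < N.pre r b) a d from
    hno (key b h)
  intro d hd
  induction hd with
  | refl => exact .refl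
  | @tail d e _ hde ih =>
    obtain ⟨r, hdr, hre⟩ := hde
    by_cases hrq : r = q
    · subst hrq
      exact absurd (hN.isMGLe.input_unique hdr hb ▸ ih) hno
    by_cases hrp : r = p
    · subst hrp
      rw [← hN.isMGLe.output_unique ha hre]
    · exact ih.tail ⟨r, by simp [hrp, hrq], hdr, hre⟩

/-- A weighting of the places of a strongly connected component that is preserved by all
transitions and has the value one at two given places. -/
theorem exists_semiflow [Fintype P] (hN : N.IsMG) {c : N.Component}
    (hc : (N.componentNet c).StronglyConnected) {p q : P} (hpq : p ≠ q)
    (hp : N.placeComponent p = c) (hq : N.placeComponent q = c) :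
    ∃ y : P → ℕ, y p = 1 ∧ y q = 1 ∧ ∀ t, ∑ x, (y x : ℤ) * N.incidence x t = 0 := by
  classical
  obtain ⟨a, b, ha, hb⟩ := hN.exists_input_output p
  obtain ⟨a', b', ha', hb'⟩ := hN.exists_input_output q
  have h1 : 0 < N.post a p := by simp [ha]
  have h2 : 0 < N.pre p b := by simp [hb]
  have h3 : 0 < N.post a' q := by simp [ha']
  have h4 : 0 < N.pre q b' := by simp [hb']
  obtain ⟨c₁, hc₁, hs₁⟩ := exists_path_count hN (exists_path_avoiding hN h2 h3
    (exists_trans_of_stronglyConnected hc ((placeComponent_eq_of_pre h2).symm.trans hp)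
      ((placeComponent_eq_of_post h3).symm.trans hq)))
  obtain ⟨c₂, hc₂, hs₂⟩ := exists_path_count hN (exists_path_avoiding hN h4 h1
    (exists_trans_of_stronglyConnected hc ((placeComponent_eq_of_pre h4).symm.trans hq)
      ((placeComponent_eq_of_post h1).symm.trans hp)))
  -- This counts the places of a closed walk through `p` and `q`; both paths avoid these two, whence
  -- the value one.
  refine ⟨Pi.single p 1 + Pi.single q 1 + c₁ + c₂, ?_, ?_, fun t => ?_⟩
  · simp [hpq, hc₁, hc₂]
  · simp [hpq.symm, hc₁, hc₂]
  · have hsingle : ∀ r, ∑ x, ((Pi.single r 1 : P → ℕ) x : ℤ) * N.incidence x t =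
        N.incidence r t := by
      intro r
      rw [Finset.sum_eq_single r] <;> simp +contextual
    simp only [Pi.add_apply, Nat.cast_add, add_mul, Finset.sum_add_distrib, hs₁, hs₂, hsingle]
    simp only [incidence, ha, hb, ha', hb']
    push_cast
    ring

end MarkedGraph

end PetriNet

/-! ### Weights and semiflows of the merged net. -/

namespace PCMGRefinement

variable {V P T : Type*} {G : SimpleGraph V} {R : PCMGRefinement G P T}

theorem WellStructured.isMG (hR : R.WellStructured) : R.base.IsMG := by
  refine ⟨R.base_isMGLe.1, fun p => ⟨?_, ?_⟩⟩
  · refine le_antisymm (R.base_isMGLe.2 p).1 (Set.one_le_encard_iff_nonempty.2 ?_)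
    have h := ((hR (R.base.placeComponent p)).2.2.2 ⟨p, rfl⟩).1
    obtain ⟨t, ht⟩ := Set.one_le_encard_iff_nonempty.1 h.ge
    exact ⟨t.1, ht⟩
  · refine le_antisymm (R.base_isMGLe.2 p).2 (Set.one_le_encard_iff_nonempty.2 ?_)
    have h := ((hR (R.base.placeComponent p)).2.2.2 ⟨p, rfl⟩).2
    obtain ⟨t, ht⟩ := Set.one_le_encard_iff_nonempty.1 h.ge
    exact ⟨t.1, ht⟩

variable [Fintype P]

theorem mem_mergeSet {v : V} {p : P} :
    p ∈ R.mergeSet v ↔ ∃ (e : G.edgeSet) (h : v ∈ (e : Sym2 V)), R.γ e ⟨v, h⟩ = p := by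
  simp [mergeSet]

theorem exists_of_mem_mergeSet {v : V} {p : P} {e : G.edgeSet} (h : p ∈ R.mergeSet v)
    (he : R.base.placeComponent p = R.β e) : ∃ h : v ∈ (e : Sym2 V), R.γ e ⟨v, h⟩ = p := by
  obtain ⟨f, hf, rfl⟩ := mem_mergeSet.1 h
  rw [R.γ_mem] at he
  obtain rfl := R.β.injective he
  exact ⟨hf, rfl⟩

/-- The places of the base net that are represented by a place of the `PCMG≤`. -/
noncomputable def fiber (R : PCMGRefinement G P T) (x : R.Place) : Finset P :=
  Sum.elim R.mergeSet (fun q => {q.1}) x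

theorem exists_mem_fiber (R : PCMGRefinement G P T) (p : P) : ∃ x, p ∈ R.fiber x := by
  by_cases h : ∀ v, p ∉ R.mergeSet v
  · exact ⟨.inr ⟨p, h⟩, Finset.mem_singleton_self p⟩
  · push Not at h
    obtain ⟨v, hv⟩ := h
    exact ⟨.inl v, hv⟩

/-- A component comes from a single edge, which attaches only one place to each of its ends. Thus,
seen from one component, merging changes no weight. -/
theorem eq_of_mem_fiber {x : R.Place} {p q : P} (hp : p ∈ R.fiber x) (hq : q ∈ R.fiber x)
    (h : R.base.placeComponent p = R.base.placeComponent q) : p = q := by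
  rcases x with v | r
  · obtain ⟨e, he, rfl⟩ := mem_mergeSet.1 hp
    obtain ⟨-, rfl⟩ := exists_of_mem_mergeSet hq (h.symm.trans (R.γ_mem e _))
    rfl
  · rw [Finset.mem_singleton.1 hp, Finset.mem_singleton.1 hq]

theorem net_pre (x : R.Place) (t : T) : R.net.pre x t = ∑ p ∈ R.fiber x, R.base.pre p t := by
  rcases x with v | q
  · rfl
  · exact (Finset.sum_singleton _ _).symm

theorem net_post (x : R.Place) (t : T) : R.net.post t x = ∑ p ∈ R.fiber x, R.base.post t p := by
  rcases x with v | q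
  · rfl
  · exact (Finset.sum_singleton _ _).symm

theorem net_incidence (x : R.Place) (t : T) :
    R.net.incidence x t = ∑ p ∈ R.fiber x, R.base.incidence p t := by
  simp only [PetriNet.incidence, net_pre, net_post, Nat.cast_sum, Finset.sum_sub_distrib]

theorem net_pre_pos {x : R.Place} {t : T} :
    0 < R.net.pre x t ↔ ∃ p ∈ R.fiber x, 0 < R.base.pre p t := by
  rw [net_pre, Finset.sum_pos_iff]

theorem net_post_pos {x : R.Place} {t : T} :
    0 < R.net.post t x ↔ ∃ p ∈ R.fiber x, 0 < R.base.post t p := by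
  rw [net_post, Finset.sum_pos_iff]

theorem net_adj {x : R.Place} {t : T} :
    R.net.Adj x t ↔ ∃ p ∈ R.fiber x, R.base.Adj p t := by
  simp only [PetriNet.Adj, net_pre_pos, net_post_pos]
  grind

theorem net_pre_le_one (x : R.Place) (t : T) : R.net.pre x t ≤ 1 := by
  by_cases h : ∃ p ∈ R.fiber x, 0 < R.base.pre p t
  · obtain ⟨p, hp, hpt⟩ := h
    rw [net_pre, Finset.sum_eq_single_of_mem p hp]
    · exact R.base_isMGLe.1.1 p t
    · intro q hq hqp
      by_contra h0
      exact hqp (eq_of_mem_fiber hq hp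
        ((PetriNet.placeComponent_eq_of_pre (Nat.pos_of_ne_zero h0)).trans
          (PetriNet.placeComponent_eq_of_pre hpt).symm))
  · rw [← net_pre_pos] at h
    omega

/-- The row of a merged place is the sum of the merged rows, so a semiflow of the base net descends
once it is constant on the merged places. -/
theorem sum_mul_net_incidence [Fintype V] [Fintype R.Place] (y : P → ℤ)
    (hy : ∀ v, ∀ p ∈ R.mergeSet v, y p = 1) (t : T) :
    ∑ x : R.Place, Sum.elim (fun _ => 1) (fun q => y q.1) x * R.net.incidence x t =
      ∑ p, y p * R.base.incidence p t := by
  classical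
  have e : ∀ F : R.Place → ℤ, ∑ x, F x = ∑ v, F (.inl v) +
      ∑ q : {p : P // ∀ v, p ∉ R.mergeSet v}, F (.inr q) := by
    intro F
    convert Fintype.sum_sum_type F
  rw [e, ← Finset.sum_filter_add_sum_filter_not Finset.univ (fun p => ∃ v, p ∈ R.mergeSet v)]
  congr 1
  · have h : Finset.univ.filter (fun p => ∃ v, p ∈ R.mergeSet v) =
        Finset.univ.biUnion R.mergeSet := by
      ext p
      simp
    rw [h, Finset.sum_biUnion fun u _ v _ huv => R.mergeSet_disjoint huv]
    refine Finset.sum_congr rfl fun v _ => ?_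
    simp only [Sum.elim_inl, one_mul, net_incidence]
    exact Finset.sum_congr rfl fun p hp => by rw [hy v p hp, one_mul]
  · rw [Finset.sum_subtype (F := inferInstance) (p := fun p => ∀ v, p ∉ R.mergeSet v) _ (by simp)]
    exact Finset.sum_congr rfl fun q _ => by simp [net_incidence, fiber]

/-- A weighting of the places that is preserved by all transitions and has the value one at the
attached places. -/
theorem WellStructured.exists_semiflow (hR : R.WellStructured) :
    ∃ y : P → ℕ, (∀ v, ∀ p ∈ R.mergeSet v, y p = 1) ∧
      ∀ t, ∑ p, (y p : ℤ) * R.base.incidence p t = 0 := by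
  have key : ∀ c : R.base.Component, ∃ y : P → ℕ,
      (∀ v, ∀ p ∈ R.mergeSet v, R.base.placeComponent p = c → y p = 1) ∧
      ∀ t, ∑ p, (y p : ℤ) * R.base.incidence p t = 0 := by
    intro c
    obtain ⟨⟨e, he⟩, rfl⟩ := R.β.surjective c
    induction e using Sym2.ind with
    | _ u v =>
      have huv : u ≠ v := (G.mem_edgeSet.1 he).ne
      obtain ⟨y, hu, hv, hy⟩ := PetriNet.exists_semiflow hR.isMG (hR (R.β ⟨s(u, v), he⟩)).1
        (p := R.γ ⟨s(u, v), he⟩ ⟨u, Sym2.mem_mk_left u v⟩)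
        (q := R.γ ⟨s(u, v), he⟩ ⟨v, Sym2.mem_mk_right u v⟩)
        (fun h => huv (congrArg Subtype.val (R.γ_injective _ h))) (R.γ_mem _ _) (R.γ_mem _ _)
      refine ⟨y, fun w p hp hc => ?_, hy⟩
      obtain ⟨hw, rfl⟩ := exists_of_mem_mergeSet hp hc
      rcases Sym2.mem_iff.1 hw with rfl | rfl
      · exact hu
      · exact hv
  choose y hy1 hy0 using key
  -- The semiflows of the components are glued: `t` sees only places of its own component.
  refine ⟨fun p => y (R.base.placeComponent p) p, fun v p hp => hy1 _ v p hp rfl, fun t => ?_⟩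
  rw [← hy0 (R.base.transComponent t) t]
  refine Finset.sum_congr rfl fun p _ => ?_
  by_cases h : R.base.Adj p t
  · simp only [PetriNet.placeComponent_eq_of_adj h]
  · simp only [PetriNet.Adj, not_or, not_lt, nonpos_iff_eq_zero] at h
    simp [PetriNet.incidence, h]

/-! ### Cuts from bridges, and the potentials they carry. -/

/-- The cut at a place `x` next to a component: for a vertex, the part of the net on its side of the
edge of that component; for any other place, the place itself. -/
theorem exists_cut (hG : G.IsAcyclic) {x : R.Place} {t : T} (hxt : R.net.Adj x t) :
    ∃ K : Set R.Place, x ∈ K ∧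
      (∀ s, R.base.transComponent s ≠ R.base.transComponent t →
        ∀ x y, R.net.Adj x s → R.net.Adj y s → x ∈ K → y ∈ K) ∧
      (∀ s, R.base.transComponent s = R.base.transComponent t →
        ∀ y, R.net.Adj y s → y ∈ K → y = x) ∧
      ((∃ v, x = .inl v) ∨ ∀ z ∈ K, ∀ s, R.net.Adj z s →
        R.base.transComponent s = R.base.transComponent t) := by
  rcases x with v | q
  · obtain ⟨p, hp, hpt⟩ := net_adj.1 hxt
    obtain ⟨⟨f, hfG⟩, hf⟩ := R.β.surjective (R.base.transComponent t)
    obtain ⟨hvf, -⟩ := exists_of_mem_mergeSet (e := ⟨f, hfG⟩) hp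
      ((PetriNet.placeComponent_eq_of_adj hpt).trans hf.symm)
    obtain ⟨u, rfl⟩ := Sym2.mem_iff_exists.1 hvf
    have hbr : ¬ (G.deleteEdges {s(v, u)}).Reachable v u :=
      SimpleGraph.isBridge_iff.1 (SimpleGraph.isAcyclic_iff_forall_isBridge.1 hG hfG)
    -- Every edge other than the bridge has both ends on the same side.
    have hside : ∀ g : G.edgeSet, (g : Sym2 V) ≠ s(v, u) → ∀ a ∈ (g : Sym2 V),
        ∀ b ∈ (g : Sym2 V), (G.deleteEdges {s(v, u)}).Reachable v a →
          (G.deleteEdges {s(v, u)}).Reachable v b := by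
      intro g hg a ha b hb hva
      by_cases hab : a = b
      · rwa [← hab]
      · have hgab : (g : Sym2 V) = s(a, b) := (Sym2.mem_and_mem_iff hab).1 ⟨ha, hb⟩
        refine hva.trans (SimpleGraph.Adj.reachable (SimpleGraph.deleteEdges_adj.2 ⟨?_, ?_⟩))
        · rw [← SimpleGraph.mem_edgeSet, ← hgab]
          exact g.2
        · rw [← hgab]
          simpa using hg
    refine ⟨{y | Sum.elim (fun w => (G.deleteEdges {s(v, u)}).Reachable v w)
      (fun q => ∃ g : G.edgeSet, R.β g = R.base.placeComponent q.1 ∧ (g : Sym2 V) ≠ s(v, u) ∧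
        ∃ w ∈ (g : Sym2 V), (G.deleteEdges {s(v, u)}).Reachable v w) y}, ?_, ?_, ?_, ?_⟩
    · exact SimpleGraph.Reachable.refl v
    · intro s hs x y hx hy hxK
      obtain ⟨g, hg⟩ := R.β.surjective (R.base.transComponent s)
      have hgf : (g : Sym2 V) ≠ s(v, u) := by
        intro h
        refine hs ?_
        rw [← hg, ← hf]
        exact congrArg R.β (Subtype.ext h)
      obtain ⟨p, hpx, hps⟩ := net_adj.1 hx
      obtain ⟨r, hry, hrs⟩ := net_adj.1 hy
      have hpc := (PetriNet.placeComponent_eq_of_adj hps).trans hg.symm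
      have hrc := (PetriNet.placeComponent_eq_of_adj hrs).trans hg.symm
      have hw : ∃ w ∈ (g : Sym2 V), (G.deleteEdges {s(v, u)}).Reachable v w := by
        rcases x with w | q
        · obtain ⟨hwg, -⟩ := exists_of_mem_mergeSet hpx hpc
          exact ⟨w, hwg, hxK⟩
        · obtain ⟨g', hg', -, hw⟩ := hxK
          rw [Finset.mem_singleton.1 hpx] at hpc
          rwa [R.β.injective (hg'.trans hpc)] at hw
      rcases y with w | q
      · obtain ⟨hwg, -⟩ := exists_of_mem_mergeSet hry hrc
        obtain ⟨a, ha, hva⟩ := hw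
        exact hside g hgf a ha w hwg hva
      · rw [Finset.mem_singleton.1 hry] at hrc
        exact ⟨g, hrc.symm, hgf, hw⟩
    · intro s hs y hy hyK
      obtain ⟨r, hry, hrs⟩ := net_adj.1 hy
      have hrc := (PetriNet.placeComponent_eq_of_adj hrs).trans (hs.trans hf.symm)
      rcases y with w | q
      · obtain ⟨hw, -⟩ := exists_of_mem_mergeSet hry hrc
        rcases Sym2.mem_iff.1 hw with rfl | rfl
        · rfl
        · exact absurd hyK hbr
      · obtain ⟨g, hg, hgf, -⟩ := hyK
        rw [Finset.mem_singleton.1 hry] at hrc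
        exact absurd (congrArg Subtype.val (R.β.injective (hg.trans hrc))) hgf
    · exact .inl ⟨v, rfl⟩
  · have hq : ∀ s, R.net.Adj (.inr q) s →
        R.base.transComponent s = R.base.transComponent t := by
      intro s hs
      obtain ⟨p, hp, hpt⟩ := net_adj.1 hxt
      obtain ⟨r, hr, hrs⟩ := net_adj.1 hs
      obtain rfl : p = r := (Finset.mem_singleton.1 hp).trans (Finset.mem_singleton.1 hr).symm
      exact (PetriNet.placeComponent_eq_of_adj hrs).symm.trans
        (PetriNet.placeComponent_eq_of_adj hpt)
    refine ⟨{.inr q}, rfl, ?_, fun _ _ _ _ h => h, .inr ?_⟩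
    · rintro s hs x y hx hy rfl
      exact absurd (hq s hx) hs
    · rintro _ rfl
      exact hq

theorem WellStructured.locallyCut (hG : G.IsAcyclic) (hR : R.WellStructured) :
    R.net.LocallyCut R.base.transComponent where
  input_unique := by
    intro x s t hs ht hst
    obtain ⟨p, hp, hps⟩ := net_post_pos.1 hs
    obtain ⟨q, hq, hqt⟩ := net_post_pos.1 ht
    obtain rfl := eq_of_mem_fiber hp hq ((PetriNet.placeComponent_eq_of_post hps).trans
      (hst.trans (PetriNet.placeComponent_eq_of_post hqt).symm))
    exact R.base_isMGLe.input_unique hps hqt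
  output_unique := by
    intro x s t hs ht hst
    obtain ⟨p, hp, hps⟩ := net_pre_pos.1 hs
    obtain ⟨q, hq, hqt⟩ := net_pre_pos.1 ht
    obtain rfl := eq_of_mem_fiber hp hq ((PetriNet.placeComponent_eq_of_pre hps).trans
      (hst.trans (PetriNet.placeComponent_eq_of_pre hqt).symm))
    exact R.base_isMGLe.output_unique hps hqt
  exists_input := by
    intro x t h
    obtain ⟨p, hp, hpt⟩ := net_adj.1 h
    obtain ⟨a, -, ha, -⟩ := hR.isMG.exists_input_output p
    have hap : 0 < R.base.post a p := by simp [ha]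
    exact ⟨a, (PetriNet.placeComponent_eq_of_post hap).symm.trans
      (PetriNet.placeComponent_eq_of_adj hpt), net_post_pos.2 ⟨p, hp, hap⟩⟩
  exists_output := by
    intro x t h
    obtain ⟨p, hp, hpt⟩ := net_adj.1 h
    obtain ⟨-, b, -, hb⟩ := hR.isMG.exists_input_output p
    have hpb : 0 < R.base.pre p b := by simp [hb]
    exact ⟨b, (PetriNet.placeComponent_eq_of_pre hpb).symm.trans
      (PetriNet.placeComponent_eq_of_adj hpt), net_pre_pos.2 ⟨p, hp, hpb⟩⟩
  cut := by
    intro x t h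
    obtain ⟨K, h1, h2, h3, -⟩ := exists_cut hG h
    exact ⟨K, h1, h2, h3⟩

theorem WellStructured.exists_potential [Fintype V] [Fintype R.Place] (hG : G.IsAcyclic)
    (hR : R.WellStructured) (x : R.Place) (t : T) (hxt : R.net.Adj x t) :
    ∃ y : R.Place → ℕ, 0 < y x ∧
      (∀ s, R.base.transComponent s ≠ R.base.transComponent t →
        ∑ z, (y z : ℤ) * R.net.incidence z s = 0) ∧
      (∀ s, R.base.transComponent s = R.base.transComponent t →
        ∀ z, R.net.Adj z s → y z ≠ 0 → z = x) := by
  classical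
  obtain ⟨K, hxK, hout, hin, hK⟩ := exists_cut hG hxt
  -- At a vertex, `w` is the global semiflow. At an unattached place no other component touches `K`,
  -- so weight one will do.
  obtain ⟨w, hwx, hw⟩ : ∃ w : R.Place → ℕ, 0 < w x ∧ ∀ s, (∃ z ∈ K, R.net.Adj z s) →
      R.base.transComponent s ≠ R.base.transComponent t →
      ∑ z, (w z : ℤ) * R.net.incidence z s = 0 := by
    rcases hK with ⟨v, rfl⟩ | hK
    · obtain ⟨y, hy1, hy0⟩ := hR.exists_semiflow
      refine ⟨Sum.elim 1 fun q => y q.1, Nat.one_pos, fun s _ _ => ?_⟩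
      rw [← hy0 s, ← sum_mul_net_incidence (fun p => (y p : ℤ)) (fun v p hp => by simp [hy1 v p hp])]
      refine Finset.sum_congr rfl fun z _ => ?_
      rcases z with z | z <;> simp
    · refine ⟨1, Nat.one_pos, fun s ⟨z, hz, hs⟩ hst => absurd (hK z hz s hs) hst⟩
  -- Truncation to `K` keeps the balance of the other components' transitions, whose places lie all
  -- inside or all outside `K`.
  refine ⟨fun z => if z ∈ K then w z else 0, by simpa [hxK], fun s hs => ?_, fun s hs z hz h => ?_⟩
  · by_cases h : ∃ z ∈ K, R.net.Adj z s
    · rw [← hw s h hs]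
      obtain ⟨z, hzK, hz⟩ := h
      refine Finset.sum_congr rfl fun z' _ => ?_
      by_cases hz' : R.net.Adj z' s
      · simp [hout s hs z z' hz hz' hzK]
      · simp only [PetriNet.Adj, not_or, not_lt, nonpos_iff_eq_zero] at hz'
        simp [PetriNet.incidence, hz']
    · refine Finset.sum_eq_zero fun z _ => ?_
      by_cases hzK : z ∈ K
      · have hz : ¬ R.net.Adj z s := fun hz => h ⟨z, hzK, hz⟩
        simp only [PetriNet.Adj, not_or, not_lt, nonpos_iff_eq_zero] at hz
        simp [PetriNet.incidence, hz]
      · simp [hzK]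
  · by_cases hzK : z ∈ K
    · exact hin s hs z hz hzK
    · simp [hzK] at h

theorem WellStructured.transConnected (hR : R.WellStructured) (s t : T)
    (hst : R.base.transComponent s = R.base.transComponent t) :
    Relation.ReflTransGen (fun a b => R.base.transComponent a = R.base.transComponent b ∧
      ∃ x, 0 < R.net.post a x ∧ 0 < R.net.pre x b) s t := by
  refine Relation.ReflTransGen.mono ?_ _ _ (PetriNet.exists_trans_of_stronglyConnected
    (hR (R.base.transComponent t)).1 hst rfl)
  rintro a b ⟨p, hap, hpb⟩
  obtain ⟨x, hx⟩ := R.exists_mem_fiber p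
  exact ⟨(PetriNet.placeComponent_eq_of_post hap).symm.trans
    (PetriNet.placeComponent_eq_of_pre hpb), x, net_post_pos.2 ⟨p, hx, hap⟩,
    net_pre_pos.2 ⟨p, hx, hpb⟩⟩

/-- A transition yields a component, hence an edge, so the connected `G` has no isolated vertex.
Without transitions, a lone vertex would be an isolated place. -/
theorem WellStructured.exists_output (hR : R.WellStructured) (hT : Nonempty T) (x : R.Place) :
    ∃ t, 0 < R.net.pre x t := by
  obtain ⟨p, hp⟩ : (R.fiber x).Nonempty := by
    rcases x with v | q
    · obtain ⟨t⟩ := hT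
      obtain ⟨e, -⟩ := R.β.surjective (R.base.transComponent t)
      have : Nontrivial V :=
        (SimpleGraph.nontrivial_iff.1 ⟨G, ⊥, fun h => by simpa [h] using e.2⟩)
      obtain ⟨u, hu⟩ := R.connected.preconnected.exists_adj_of_nontrivial v
      exact ⟨_, mem_mergeSet.2 ⟨⟨s(v, u), hu⟩, Sym2.mem_mk_left v u, rfl⟩⟩
    · exact ⟨q.1, Finset.mem_singleton_self _⟩
  obtain ⟨-, b, -, hb⟩ := hR.isMG.exists_input_output p
  exact ⟨b, net_pre_pos.2 ⟨p, hp, by simp [hb]⟩⟩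

end PCMGRefinement

theorem mainTheorem6 {V P T : Type*} [Finite V] [Fintype P] [Finite T]
    (G : SimpleGraph V) (hG : G.IsAcyclic)
    (R : PCMGRefinement G P T) (hR : R.WellStructured) (hT : Nonempty T)
    (M₀ : R.Place → ℕ) :
    (R.net.Live M₀ ↔ ∀ D : Set R.Place, R.net.IsMinimalSiphon D → PetriNet.Marked M₀ D) ∧
    (R.net.Live M₀ ↔ ∀ Q : Set R.Place, R.net.IsMinimalTrap Q → PetriNet.Marked M₀ Q) ∧
    (∀ D : Set R.Place, R.net.IsMinimalSiphon D ↔ R.net.IsMinimalTrap D) := by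
  classical
  cases nonempty_fintype V
  have hcut := hR.locallyCut hG
  have hiff := hcut.isMinimalSiphon_iff_isMinimalTrap
  have hlive : R.net.Live M₀ ↔
      ∀ D : Set R.Place, R.net.IsMinimalSiphon D → PetriNet.Marked M₀ D :=
    ⟨fun h D hD => h.marked_of_isSiphon hD.prop (hR.exists_output hT),
      hcut.live_of_marked PCMGRefinement.net_pre_le_one (hR.exists_potential hG)
        hR.transConnected⟩
  exact ⟨hlive, by simpa only [hiff] using hlive, hiff⟩
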